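/- Let $\mathcal X$ be a finite set of cardinality $N$, let $\nu$ be a strictly positive function on $\mathcal X$, and let $\tilde{\mathcal T}\subseteq\mathbb R^{\mathcal X}$ be a linear subspace containing the constant functions. Let $\mathcal E$ be the exponential family with reference measure $\nu$ and extended tangent space $\tilde{\mathcal T}$, i.e. the set of all probability measures on $\mathcal X$ of the form $P_\vartheta(x)=\frac{\nu(x)}{Z_\vartheta}e^{\vartheta(x)}$ with $\vartheta\in\tilde{\mathcal T}$ and $Z_\vartheta=\sum_{y\in\mathcal X}\nu(y)e^{\vartheta(y)}$. Its dimension $\dim\mathcal E$ is the dimension of $\tilde{\mathcal T}$ modulo the constant functions, and its normal space is $\mathcal N=\tilde{\mathcal T}^{\perp}\subseteq\mathbb R^{\mathcal X}$. For a probability measure $P$ on $\mathcal X$ let $D_{\mathcal E}(P)=\inf_{Q\in\mathcal E}D(P\|Q)$, where $D(P\|Q)=\sum_{x}P(x)\log\frac{P(x)}{Q(x)}$ is the information divergence (with $0\log 0=0$, and $D(P\|Q)=\infty$ if $Q(x)=0<P(x)$ for some $x$). Let $M$ be the matroid on $\mathcal X$ whose circuits are the inclusion-minimal supports of nonzero elements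 of $\mathcal N$. On $\underline{\mathcal X}=\{x\in\mathcal X: v(x)\ne 0\text{ for some }v\in\mathcal N\}$ define the equivalence relation $x\sim y$ if and only if $v(y)\neq 0$ for all $v\in\mathcal N$ with $v(x)\ne 0$; its equivalence classes are the coparallel classes of $M$. The corank of a set $\mathcal Z\subseteq\mathcal X$ is its rank in the dual matroid $M^{*}$. If $\max_P D_{\mathcal E}(P)=\log 2$, the maximum being over all probability measures $P$ on $\mathcal X$, then $$\dim\mathcal E\ \ge\ \left\lceil \tfrac N2\right\rceil-1,$$ and every coparallel class of $M$ has at least two elements and corank one. -/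

import Mathlib

/-- Data defining an exponential family on a finite set `X`: a strictly positive reference measure
and an extended tangent space, a linear space of functions containing the constants. -/
structure ExponentialFamily (X : Type*) [Fintype X] where
  refMeasure : X → ℝ
  refMeasure_pos : ∀ x, 0 < refMeasure x
  extTangent : Submodule ℝ (X → ℝ)
  const_mem : (fun _ => (1 : ℝ)) ∈ extTangent

namespace ExponentialFamily

variable {X : Type*} [Fintype X]

/-- The exponential family as a set: all probability measures on `X` of the form
`P x = ν x / Z * exp (θ x)` with `θ` in the extended tangent space and `Z` the normalization. -/
def members (E : ExponentialFamily X) : Set (X → ℝ) :=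
  {P | P ∈ stdSimplex ℝ X ∧ ∃ θ ∈ E.extTangent, ∀ x,
    P x = E.refMeasure x / (∑ y, E.refMeasure y * Real.exp (θ y)) * Real.exp (θ x)}

/-- The normal space: the orthogonal complement of the extended tangent space in `ℝ^X`. -/
def normalSpace (E : ExponentialFamily X) : Submodule ℝ (X → ℝ) where
  carrier := {u | ∀ θ ∈ E.extTangent, ∑ x, u x * θ x = 0}
  zero_mem' := by intro θ _; simp
  add_mem' := by
    intro u v hu hv θ hθ
    simp only [Pi.add_apply, add_mul, Finset.sum_add_distrib, hu θ hθ, hv θ hθ, add_zero]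
  smul_mem' := by
    intro c u hu θ hθ
    simp only [Pi.smul_apply, smul_eq_mul, mul_assoc, ← Finset.mul_sum, hu θ hθ, mul_zero]

/-- The dimension of the exponential family: the dimension of its tangent space, which is the
extended tangent space modulo the constant functions. -/
noncomputable def dim (E : ExponentialFamily X) : ℕ :=
  Module.finrank ℝ
    (E.extTangent.map (Submodule.span ℝ {(fun _ => 1 : X → ℝ)}).mkQ)

end ExponentialFamily

open Classical in
/-- Information divergence `∑ x, P x * log (P x / Q x)` of non-negative vectors, equal to `⊤` unless
the support of `P` is contained in that of `Q`. (Terms with `P x = 0` vanish.) -/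
noncomputable def infDivergence {X : Type*} [Fintype X] (P Q : X → ℝ) : EReal :=
  if ∀ x, Q x = 0 → P x = 0 then ((∑ x, P x * Real.log (P x / Q x) : ℝ) : EReal) else ⊤

/-- `D_E(P) = inf_{Q ∈ E} D(P ‖ Q)`. -/
noncomputable def ExponentialFamily.divergenceFrom {X : Type*} [Fintype X]
    (E : ExponentialFamily X) (P : X → ℝ) : EReal :=
  ⨅ Q ∈ E.members, infDivergence P Q

/-- A set is independent for a linear space `V` of functions if it contains the support of no
nonzero element of `V`. -/
def IndepOfSpace {X : Type*} (V : Submodule ℝ (X → ℝ)) (I : Set X) : Prop :=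
  ∀ u ∈ V, Function.support u ⊆ I → u = 0

theorem IndepOfSpace.augment {X : Type*} [Fintype X] {V : Submodule ℝ (X → ℝ)} {I J : Set X}
    (hI : IndepOfSpace V I) (hJ : IndepOfSpace V J) (hIJ : I.ncard < J.ncard) :
    ∃ e ∈ J, e ∉ I ∧ IndepOfSpace V (insert e I) := by
  classical
  have mem_iff : ∀ (S : Set X) (u : X → ℝ),
      u ∈ Pi.spanSubset ℝ S ↔ Function.support u ⊆ S := by
    intro S u
    rw [Pi.mem_spanSubset_iff]
    simp only [Function.support_subset_iff']
  have inf_bot : ∀ S : Set X, IndepOfSpace V S → Pi.spanSubset ℝ S ⊓ V = ⊥ := by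
    intro S hS
    rw [eq_bot_iff]
    rintro u ⟨hu, huV⟩
    exact (Submodule.mem_bot ℝ).2 (hS u huV ((mem_iff S u).1 hu))
  by_contra! hcon
  have key : ∀ e ∈ J, (Pi.single e 1 : X → ℝ) ∈ Pi.spanSubset ℝ I ⊔ V := by
    intro e heJ
    by_cases heI : e ∈ I
    · refine Submodule.mem_sup_left ((mem_iff I _).2 ?_)
      exact Pi.support_single_subset.trans (Set.singleton_subset_iff.2 heI)
    · have hdep := hcon e heJ heI
      unfold IndepOfSpace at hdep
      push Not at hdep
      obtain ⟨u, huV, hus, hu0⟩ := hdep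
      have hue : u e ≠ 0 := by
        intro h
        refine hu0 (hI u huV fun x hx => ?_)
        rcases hus hx with rfl | hxI
        · exact absurd h hx
        · exact hxI
      have hsplit : (Pi.single e 1 : X → ℝ)
          = (Pi.single e 1 - (u e)⁻¹ • u) + (u e)⁻¹ • u := by abel
      rw [hsplit]
      refine Submodule.add_mem_sup ((mem_iff I _).2 fun x hx => ?_) (V.smul_mem _ huV)
      by_contra hxI
      by_cases hxe : x = e
      · subst hxe
        simp [hue] at hx
      · have hux : u x = 0 := by
          by_contra h
          rcases hus h with h' | h'
          · exact hxe h'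
          · exact hxI h'
        simp [hxe, hux] at hx
  have hle : Pi.spanSubset ℝ J ⊔ V ≤ Pi.spanSubset ℝ I ⊔ V := by
    refine sup_le ?_ le_sup_right
    intro u hu
    have hu' := (mem_iff J u).1 hu
    rw [pi_eq_sum_univ' u]
    refine Submodule.sum_mem _ fun x _ => ?_
    by_cases hx : u x = 0
    · simp [hx]
    · refine Submodule.smul_mem _ _ ?_
      have := key x (hu' hx)
      convert this using 1
  have h1 := Submodule.finrank_mono hle
  have h2 := Submodule.finrank_sup_add_finrank_inf_eq (Pi.spanSubset ℝ J) V
  have h3 := Submodule.finrank_sup_add_finrank_inf_eq (Pi.spanSubset ℝ I) V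
  rw [inf_bot _ hJ, finrank_bot, Pi.dim_spanSubset] at h2
  rw [inf_bot _ hI, finrank_bot, Pi.dim_spanSubset] at h3
  omega

/-- The matroid on `X` of a linear space `V ⊆ ℝ^X`: its circuits are the inclusion-minimal supports
of nonzero elements of `V`, and its independent sets are the sets that contain no circuit. -/
def matroidOfSpace {X : Type*} [Fintype X] (V : Submodule ℝ (X → ℝ)) : Matroid X :=
  (IndepMatroid.ofFinite (E := Set.univ) Set.finite_univ (IndepOfSpace V)
    (by
      intro u _ hu
      exact Function.support_eq_empty_iff.1 (Set.subset_empty_iff.1 hu))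
    (fun _ _ hJ hIJ u hu hs => hJ u hu (hs.trans hIJ))
    (fun _ _ hI hJ h => hI.augment hJ h)
    (fun _ _ => Set.subset_univ _)).matroid

/-- The union of the supports of the elements of `V`. -/
def spaceSupport {X : Type*} (V : Submodule ℝ (X → ℝ)) : Set X :=
  {x | ∃ v ∈ V, v x ≠ 0}

/-- `x ∼ y` on `spaceSupport V`: every `v ∈ V` with `v x ≠ 0` has `v y ≠ 0`. This is an equivalence
relation on `spaceSupport V`, whose classes are the coparallel classes of the matroid of `V`. -/
def Coparallel {X : Type*} (V : Submodule ℝ (X → ℝ)) (x y : X) : Prop :=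
  x ∈ spaceSupport V ∧ y ∈ spaceSupport V ∧ ∀ v ∈ V, v x ≠ 0 → v y ≠ 0

/-- `Z` is a coparallel class: the equivalence class of some point of `spaceSupport V`. -/
def IsCoparallelClass {X : Type*} (V : Submodule ℝ (X → ℝ)) (Z : Set X) : Prop :=
  ∃ x ∈ spaceSupport V, Z = {y | Coparallel V x y}

/-! Write `F u = ∑ u log(|u|/ν)` for the signed divergence. For `u` in the normal space, scaled so
that its positive and negative parts are probability vectors, the divergences of the two parts from
any member `Q` differ by `F u`, whatever `Q` is. By Gibbs, `exp` of minus each divergence is at most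
the `Q`-mass of that part's support. The supports are disjoint, so these masses add up to at most 1,
and the positive part has divergence at least `log (1 + exp (F u))`. The bound `log 2` thus forces
`F u ≤ 0`; since `F` is odd, it vanishes on the whole normal space.

In `F (u + t v) = 0`, as `t → 0+`, the `t log t` term has coefficient `∑ v` over the zeros of `u`,
so this sum is 0. Choosing `u` to vanish, within the support of the space, exactly on one coparallel
class shows that every normal vector sums to zero on each class; hence no class is a singleton. A
minimal coordinate set determining normal vectors contains no two coparallel points, so pairing its
points with partners bounds the dimension of the normal space by half the cardinality. -/

/-- Gibbs' inequality: the divergence from `w` to `Q` is at least `-log` of the `Q`-mass of the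
support of `w`. -/
theorem exp_neg_divergence_le {X : Type*} [Fintype X] {w Q : X → ℝ} (hw : ∀ x, 0 ≤ w x)
    (hw1 : ∑ x, w x = 1) (hQ : ∀ x, 0 < Q x) :
    Real.exp (-∑ x, w x * Real.log (w x / Q x)) ≤ ∑ x with w x ≠ 0, Q x := by
  have hsum : ∑ x with w x ≠ 0, w x = 1 := by rw [Finset.sum_filter_ne_zero, hw1]
  -- Jensen for `exp` with weights `w`, restricted to the support of `w`, where `w * exp (log (Q /
  -- w)) = Q`.
  have hJ := convexOn_exp.map_sum_le (t := Finset.univ.filter fun x => w x ≠ 0) (w := w)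
    (p := fun x => Real.log (Q x / w x)) (fun x _ => hw x) hsum (fun _ _ => Set.mem_univ _)
  have hL : ∑ x with w x ≠ 0, w x • Real.log (Q x / w x)
      = -∑ x, w x * Real.log (w x / Q x) := by
    rw [Finset.sum_filter, ← Finset.sum_neg_distrib]
    refine Finset.sum_congr rfl fun x _ => ?_
    split_ifs with h
    · rw [smul_eq_mul, ← inv_div, Real.log_inv]; ring
    · simp [not_not.1 h]
  rw [hL] at hJ
  refine hJ.trans (le_of_eq (Finset.sum_congr rfl fun x hx => ?_))
  have hx0 : 0 < w x := lt_of_le_of_ne (hw x) (Ne.symm (Finset.mem_filter.1 hx).2)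
  rw [Real.exp_log (div_pos (hQ x) hx0), smul_eq_mul]
  field_simp

/-! ### Signed divergence and its logarithmic singularity -/

/-- The signed divergence `∑ x, u x * log (|u x| / ν x)` of a real function. -/
noncomputable def signedDivergence {X : Type*} [Fintype X] (ν u : X → ℝ) : ℝ :=
  ∑ x, u x * Real.log (u x / ν x)

theorem signedDivergence_neg {X : Type*} [Fintype X] (ν u : X → ℝ) :
    signedDivergence ν (-u) = -signedDivergence ν u := by
  simp only [signedDivergence, Pi.neg_apply, neg_div, Real.log_neg_eq_log, neg_mul,
    Finset.sum_neg_distrib]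

/-- Scaling adds only `c log|c| ∑ u`, which is zero. -/
theorem signedDivergence_smul {X : Type*} [Fintype X] {ν u : X → ℝ} (hν : ∀ x, 0 < ν x)
    (hu : ∑ x, u x = 0) {c : ℝ} (hc : c ≠ 0) :
    signedDivergence ν (c • u) = c * signedDivergence ν u := by
  have h : ∀ x, (c • u) x * Real.log ((c • u) x / ν x)
      = c * (u x * Real.log (u x / ν x)) + c * Real.log c * u x := by
    intro x
    by_cases hx : u x = 0
    · simp [hx]
    · rw [Pi.smul_apply, smul_eq_mul, mul_div_assoc,
        Real.log_mul hc (div_ne_zero hx (hν x).ne')]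
      ring
  simp only [signedDivergence, h, Finset.sum_add_distrib, ← Finset.mul_sum, hu]
  ring

/-- The pointwise decomposition of a signed divergence into positive and negative parts. -/
theorem mul_log_div_eq_posPart_sub_negPart (a q : ℝ) :
    a * Real.log (a / q)
      = max a 0 * Real.log (max a 0 / q) - max (-a) 0 * Real.log (max (-a) 0 / q) := by
  rcases le_total 0 a with h | h
  · simp [max_eq_left h, max_eq_right (neg_nonpos.2 h)]
  · simp [max_eq_right h, max_eq_left (neg_nonneg.2 h), neg_div]

/-- If positive and negative parts of `u` are probability vectors, the divergence of the positive
part from a positive probability vector is at least `log (1 + exp (signedDivergence Q u))`. -/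
theorem log_one_add_exp_signedDivergence_le {X : Type*} [Fintype X] {u Q : X → ℝ} (hQ : ∀ x, 0 < Q x)
    (hQ1 : ∑ x, Q x = 1) (hp : ∑ x, max (u x) 0 = 1) (hn : ∑ x, max (-u x) 0 = 1) :
    Real.log (1 + Real.exp (signedDivergence Q u))
      ≤ ∑ x, max (u x) 0 * Real.log (max (u x) 0 / Q x) := by
  have h1 := exp_neg_divergence_le (fun x => le_max_right (u x) 0) hp hQ
  have h2 := exp_neg_divergence_le (fun x => le_max_right (-u x) 0) hn hQ
  have hF : signedDivergence Q u = (∑ x, max (u x) 0 * Real.log (max (u x) 0 / Q x))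
      - ∑ x, max (-u x) 0 * Real.log (max (-u x) 0 / Q x) := by
    rw [signedDivergence, ← Finset.sum_sub_distrib]
    exact Finset.sum_congr rfl fun x _ => mul_log_div_eq_posPart_sub_negPart _ _
  -- No point carries both a positive and a negative part.
  have h3 : (∑ x with max (u x) 0 ≠ 0, Q x) + ∑ x with max (-u x) 0 ≠ 0, Q x ≤ 1 := by
    rw [Finset.sum_filter, Finset.sum_filter, ← Finset.sum_add_distrib, ← hQ1]
    refine Finset.sum_le_sum fun x _ => ?_
    rcases le_total 0 (u x) with h | h
    · rw [max_eq_right (neg_nonpos.2 h)]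
      have := (hQ x).le
      split_ifs <;> simp_all
    · rw [max_eq_right h]
      have := (hQ x).le
      split_ifs <;> simp_all
  rw [hF]
  generalize (∑ x, max (u x) 0 * Real.log (max (u x) 0 / Q x)) = a at *
  generalize (∑ x, max (-u x) 0 * Real.log (max (-u x) 0 / Q x)) = b at *
  rw [Real.log_le_iff_le_exp (by positivity)]
  have h4 : Real.exp (-a) + Real.exp (-b) ≤ 1 := by linarith
  calc 1 + Real.exp (a - b) = Real.exp a * (Real.exp (-a) + Real.exp (-b)) := by
        rw [mul_add, ← Real.exp_add, ← Real.exp_add]; simp [sub_eq_add_neg]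
    _ ≤ Real.exp a * 1 := by gcongr
    _ = Real.exp a := mul_one _

/-- The part of the difference quotient carrying a logarithmic singularity must vanish. -/
theorem sum_eq_zero_of_signedDivergence_eq_zero {X : Type*} [Fintype X] {ν u v : X → ℝ}
    (hν : ∀ x, 0 < ν x) (h : ∀ t : ℝ, signedDivergence ν (u + t • v) = 0) :
    ∑ x with u x = 0, v x = 0 := by
  set S := ∑ x with u x = 0, v x with hS
  set c := ∑ x with u x = 0, v x * Real.log (v x / ν x) with hc
  -- `g` is the smooth part of the sum. The terms with `u x = 0` contribute `t * (S * log t + c)`,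
  -- so `g t / t` can converge at `0+` only if `S = 0`.
  set g : ℝ → ℝ := fun t => ∑ x with ¬ u x = 0,
    (u x + t * v x) * Real.log ((u x + t * v x) / ν x) with hg
  have hdecomp : ∀ t : ℝ, 0 < t → g t = -(t * (S * Real.log t + c)) := by
    intro t ht
    have h0 := h t
    rw [signedDivergence, ← Finset.sum_filter_add_sum_filter_not _ (fun x => u x = 0)] at h0
    have h1 : ∑ x with u x = 0, (u + t • v) x * Real.log ((u + t • v) x / ν x)
        = t * (S * Real.log t + c) := by
      rw [hS, hc, Finset.sum_mul, ← Finset.sum_add_distrib, Finset.mul_sum]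
      refine Finset.sum_congr rfl fun x hx => ?_
      have hx0 : u x = 0 := (Finset.mem_filter.1 hx).2
      by_cases hv : v x = 0
      · simp [hx0, hv]
      · simp only [Pi.add_apply, Pi.smul_apply, hx0, zero_add, smul_eq_mul]
        rw [mul_div_assoc, Real.log_mul ht.ne' (div_ne_zero hv (hν x).ne')]
        ring
    rw [h1] at h0
    simp only [Pi.add_apply, Pi.smul_apply, smul_eq_mul] at h0
    simp only [hg]
    linarith
  have hg0 : g 0 = 0 := by
    have h0 := h 0
    rw [zero_smul, add_zero, signedDivergence,
      ← Finset.sum_filter_add_sum_filter_not _ (fun x => u x = 0)] at h0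
    rw [Finset.sum_eq_zero (fun x hx => by simp [(Finset.mem_filter.1 hx).2]), zero_add] at h0
    simpa [hg] using h0
  have hdiff : DifferentiableAt ℝ g 0 := by
    refine DifferentiableAt.fun_sum fun x hx => ?_
    have hx0 : u x ≠ 0 := (Finset.mem_filter.1 hx).2
    have hne : (u x + 0 * v x) / ν x ≠ 0 := by simpa using ⟨hx0, (hν x).ne'⟩
    have hlin : DifferentiableAt ℝ (fun t : ℝ => u x + t * v x) 0 := by fun_prop
    exact hlin.mul ((hlin.div_const _).log hne)
  have hlim := hdiff.hasDerivAt.tendsto_slope_zero_right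
  have hlim2 : Filter.Tendsto (fun t : ℝ => S * Real.log t) (nhdsWithin 0 (Set.Ioi 0))
      (nhds (-deriv g 0 - c)) := by
    refine (hlim.neg.sub_const c).congr' ?_
    filter_upwards [self_mem_nhdsWithin] with t ht
    have ht' : (0 : ℝ) < t := ht
    rw [zero_add, hg0, hdecomp t ht', smul_eq_mul]
    field_simp
    ring
  by_contra hne
  refine not_tendsto_nhds_of_tendsto_atBot Real.tendsto_log_nhdsGT_zero _
    ((hlim2.const_mul S⁻¹).congr fun t => ?_)
  field_simp

/-! ### Coparallel classes, dimension and corank -/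

/-- If `w` were nonzero at `y` but zero at `x`, subtracting a multiple of it from a vector nonzero
at `x` would kill the value at `y` and keep that at `x`. -/
theorem Coparallel.symm {X : Type*} {V : Submodule ℝ (X → ℝ)} {x y : X}
    (h : Coparallel V x y) : Coparallel V y x := by
  obtain ⟨⟨v, hv, hvx⟩, hy, hxy⟩ := h
  refine ⟨hy, ⟨v, hv, hvx⟩, fun w hw hwy hwx => ?_⟩
  refine hxy (v - (v y / w y) • w) (V.sub_mem hv (V.smul_mem _ hw)) ?_ ?_
  · simpa [hwx] using hvx
  · simp [hwy]

/-- Of the elements of `V` vanishing at `x`, one vanishes on `spaceSupport V` only at the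
coparallel class of `x`. -/
theorem exists_zero_set_eq_coparallel {X : Type*} [Fintype X] (V : Submodule ℝ (X → ℝ)) {x : X}
    (hx : x ∈ spaceSupport V) :
    ∃ u ∈ V, ∀ y ∈ spaceSupport V, u y = 0 ↔ Coparallel V x y := by
  classical
  -- A vector of maximal support among those vanishing at `x`: its zeros are then the common zeros
  -- of all of them.
  obtain ⟨s, ⟨u, hu, hux, rfl⟩, hmax⟩ := Set.Finite.exists_maximal
    (s := {s : Set X | ∃ u ∈ V, u x = 0 ∧ Function.support u = s}) (Set.toFinite _)
    ⟨_, 0, V.zero_mem, rfl, rfl⟩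
  refine ⟨u, hu, fun y hy => ⟨fun huy => ?_, fun hxy => ?_⟩⟩
  · by_contra hcon
    have hnot : ∃ w ∈ V, w x = 0 ∧ w y ≠ 0 := by
      by_contra! hw
      exact hcon (Coparallel.symm ⟨hy, hx, fun v hv hvy hvx => hvy (hw v hv hvx)⟩)
    obtain ⟨w, hw, hwx, hwy⟩ := hnot
    -- Avoiding finitely many values of `t` prevents any cancellation, so adding `t • w` strictly
    -- enlarges the support.
    obtain ⟨t, ht⟩ := Infinite.exists_notMem_finset
      (insert (0 : ℝ) (Finset.univ.image fun z => -u z / w z))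
    simp only [Finset.mem_insert, Finset.mem_image, Finset.mem_univ, true_and, not_or,
      not_exists] at ht
    have hsub : Function.support u ⊆ Function.support (u + t • w) := by
      intro z hz hzero
      have hzero' : u z + t * w z = 0 := hzero
      have hwz : w z ≠ 0 := by
        rintro h
        exact hz (by simpa [h] using hzero')
      exact ht.2 z (by field_simp; linarith)
    have := hmax ⟨u + t • w, V.add_mem hu (V.smul_mem _ hw), by simp [hux, hwx], rfl⟩ hsub
    have hmem : y ∈ Function.support (u + t • w) := by
      simp [huy, ht.1, hwy]
    exact this hmem huy
  · by_contra huy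
    exact hxy.symm.2.2 u hu huy hux

/-- A subspace of `ℝ^X` all of whose points of support have a coparallel partner has dimension at
most half the cardinality of `X`. -/
theorem two_mul_finrank_le_card {X : Type*} [Fintype X] (V : Submodule ℝ (X → ℝ))
    (h : ∀ x ∈ spaceSupport V, ∃ y, y ≠ x ∧ Coparallel V x y) :
    2 * Module.finrank ℝ V ≤ Fintype.card X := by
  classical
  -- `B` is a minimal set of coordinates determining the elements of `V`. Minimality gives each `b ∈
  -- B` a vector vanishing on the rest of `B` but not at `b`, so distinct points of `B` are not
  -- coparallel.
  obtain ⟨B, hB, hmin⟩ := Set.Finite.exists_minimal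
    (s := {B : Finset X | ∀ v ∈ V, (∀ b ∈ B, v b = 0) → v = 0}) (Set.toFinite _)
    ⟨Finset.univ, fun v _ hv => funext fun b => hv b (Finset.mem_univ b)⟩
  have hsep : ∀ b ∈ B, ∃ v ∈ V, v b ≠ 0 ∧ ∀ b' ∈ B, b' ≠ b → v b' = 0 := by
    intro b hb
    by_contra! hcon
    have : B.erase b ∈ {B : Finset X | ∀ v ∈ V, (∀ b ∈ B, v b = 0) → v = 0} := by
      intro v hv hv0
      refine hB v hv fun b' hb' => ?_
      by_contra hne
      have hbb : b' = b := by
        by_contra hbb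
        exact hne (hv0 b' (Finset.mem_erase.2 ⟨hbb, hb'⟩))
      subst hbb
      obtain ⟨b'', hb'', hne'', h''⟩ := hcon v hv hne
      exact h'' (hv0 b'' (Finset.mem_erase.2 ⟨hne'', hb''⟩))
    exact Finset.notMem_erase b B (hmin this (Finset.erase_subset b B) hb)
  have hpair : ∀ b ∈ B, ∀ b' ∈ B, (∀ v ∈ V, v b ≠ 0 → v b' ≠ 0) → b' = b := by
    intro b hb b' hb' hbb'
    obtain ⟨v, hv, hvb, hv0⟩ := hsep b hb
    by_contra hne
    exact hbb' v hv hvb (hv0 b' hb' hne)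
  have hpartner : ∀ b : X, ∃ y, b ∈ B → y ≠ b ∧ Coparallel V b y := by
    intro b
    by_cases hb : b ∈ B
    · obtain ⟨v, hv, hvb, -⟩ := hsep b hb
      obtain ⟨y, hy⟩ := h b ⟨v, hv, hvb⟩
      exact ⟨y, fun _ => hy⟩
    · exact ⟨b, fun hb' => absurd hb' hb⟩
  choose φ hφ using hpartner
  have hdisj : Disjoint B (B.image φ) := by
    rw [Finset.disjoint_left]
    intro y hy hy'
    obtain ⟨b, hb, rfl⟩ := Finset.mem_image.1 hy'
    exact (hφ b hb).1 (hpair b hb _ hy (hφ b hb).2.2.2)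
  have hinj : Set.InjOn φ B := by
    intro b hb b' hb' hbb'
    refine (hpair b hb b' hb' fun v hv hvb => ?_).symm
    have h1 := (hφ b hb).2.2.2 v hv hvb
    rw [hbb'] at h1
    exact (hφ b' hb').2.symm.2.2 v hv h1
  have hcard : 2 * B.card ≤ Fintype.card X := by
    have := Finset.card_le_univ (B ∪ B.image φ)
    rw [Finset.card_union_of_disjoint hdisj, Finset.card_image_of_injOn hinj] at this
    omega
  have hle : Module.finrank ℝ V ≤ B.card := by
    have hi : Function.Injective
        ((LinearMap.funLeft ℝ ℝ (Subtype.val : B → X)).comp V.subtype) := by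
      rw [← LinearMap.ker_eq_bot, LinearMap.ker_eq_bot']
      rintro ⟨v, hv⟩ hv0
      exact Subtype.ext (hB v hv fun b hb => congrFun hv0 ⟨b, hb⟩)
    simpa using LinearMap.finrank_le_finrank_of_injective hi
  omega

/-- Every coparallel class has corank one. -/
theorem IsCoparallelClass.dual_eRk_eq_one {X : Type*} [Fintype X] {V : Submodule ℝ (X → ℝ)}
    {Z : Set X} (hZ : IsCoparallelClass V Z) : (matroidOfSpace V)✶.eRk Z = 1 := by
  classical
  obtain ⟨x, hx, rfl⟩ := hZ
  have hind : ∀ I, (matroidOfSpace V).Indep I ↔ IndepOfSpace V I := fun I => Iff.rfl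
  have hE : (matroidOfSpace V).E = Set.univ := rfl
  have hxx : Coparallel V x x := ⟨hx, hx, fun _ _ h => h⟩
  have hsingle : (matroidOfSpace V)✶.Indep {x} := by
    obtain ⟨s, ⟨v, hv, hvx, rfl⟩, hmin⟩ := Set.Finite.exists_minimal
      (s := {s : Set X | ∃ v ∈ V, v x ≠ 0 ∧ Function.support v = s}) (Set.toFinite _)
      (by obtain ⟨v, hv, hvx⟩ := hx; exact ⟨_, v, hv, hvx, rfl⟩)
    -- `support v` is minimal among supports containing `x`. A nonzero `w` supported in it off `x`
    -- could be used to eliminate another point, keeping `x`.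
    have hI : (matroidOfSpace V).Indep (Function.support v \ {x}) := by
      rw [hind]
      intro w hw hws
      by_contra hw0
      obtain ⟨y, hy⟩ := Function.ne_iff.1 hw0
      have hwx : w x = 0 := by
        by_contra h
        exact (hws h).2 rfl
      have hsub : Function.support (v - (v y / w y) • w) ⊆ Function.support v := by
        intro z hz hvz
        have hwz : w z = 0 := by
          by_contra h
          exact (hws h).1 hvz
        exact hz (by simp [hvz, hwz])
      have := hmin ⟨v - (v y / w y) • w, V.sub_mem hv (V.smul_mem _ hw),
        by simpa [hwx] using hvx, rfl⟩ hsub (hws hy).1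
      exact this (by
        have hy' : w y ≠ 0 := hy
        simp [hy'])
    obtain ⟨B, hB, hIB⟩ := hI.exists_isBase_superset
    rw [Matroid.dual_indep_iff_exists]
    refine ⟨B, hB, Set.disjoint_singleton_left.2 fun hxB => ?_⟩
    have h0 := (hind B).1 hB.indep v hv fun z hz => by
      by_cases hzx : z = x
      · exact hzx ▸ hxB
      · exact hIB ⟨hz, hzx⟩
    exact hvx (by simp [h0])
  refine le_antisymm ?_ ?_
  · rw [Matroid.eRk_le_iff]
    intro I hIZ hI
    rw [Set.encard_le_one_iff]
    intro a b ha hb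
    by_contra hab
    rw [Matroid.dual_indep_iff_exists] at hI
    obtain ⟨B, hB, hdisj⟩ := hI
    have haB : a ∉ B := Set.disjoint_left.1 hdisj ha
    have hbB : b ∉ B := Set.disjoint_left.1 hdisj hb
    -- Adding `a` to the base creates a vector supported in `insert a B` and nonzero at `a`; being
    -- coparallel, `b` must lie in its support too.
    have hdep := (hB.insert_dep (e := a) ⟨hE ▸ Set.mem_univ a, haB⟩).not_indep
    rw [hind] at hdep
    unfold IndepOfSpace at hdep
    push Not at hdep
    obtain ⟨w, hw, hws, hw0⟩ := hdep
    have hwa : w a ≠ 0 := by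
      intro h
      refine hw0 ((hind B).1 hB.indep w hw fun z hz => ?_)
      rcases hws hz with rfl | hzB
      · exact absurd h hz
      · exact hzB
    have hwb : w b ≠ 0 := (hIZ hb).2.2 w hw ((hIZ ha).symm.2.2 w hw hwa)
    rcases hws hwb with h | h
    · exact hab h.symm
    · exact hbB h
  · rw [← Set.encard_singleton x, ← hsingle.eRk_eq_encard]
    exact Matroid.eRk_mono _ (Set.singleton_subset_iff.2 hxx)

/-! ### Application to the exponential family -/

namespace ExponentialFamily

variable {X : Type*} [Fintype X]

theorem sum_eq_zero_of_mem_normalSpace (E : ExponentialFamily X) {u : X → ℝ}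
    (hu : u ∈ E.normalSpace) : ∑ x, u x = 0 := by
  simpa using hu _ E.const_mem

/-- The dual annihilator embeds into the normal space by evaluating functionals at the standard
basis. -/
theorem card_le_finrank_add_finrank_normalSpace (E : ExponentialFamily X) :
    Fintype.card X ≤ Module.finrank ℝ E.extTangent + Module.finrank ℝ E.normalSpace := by
  classical
  have h1 := Subspace.finrank_add_finrank_dualAnnihilator_eq E.extTangent
  rw [Module.finrank_fintype_fun_eq_card] at h1
  have hsum : ∀ (f : Module.Dual ℝ (X → ℝ)) (θ : X → ℝ),
      ∑ x, f (Pi.single x 1) * θ x = f θ := by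
    intro f θ
    conv_rhs => rw [pi_eq_sum_univ' θ, map_sum]
    refine Finset.sum_congr rfl fun x _ => ?_
    rw [map_smul, smul_eq_mul, mul_comm]
  let L : E.extTangent.dualAnnihilator →ₗ[ℝ] E.normalSpace :=
    { toFun := fun f => ⟨fun x => f.1 (Pi.single x 1), fun θ hθ => by
        rw [hsum]
        exact (Submodule.mem_dualAnnihilator f.1).1 f.2 θ hθ⟩
      map_add' := fun f g => rfl
      map_smul' := fun c f => rfl }
  have hL : Function.Injective L := by
    rw [injective_iff_map_eq_zero]
    intro f hf
    refine Subtype.ext (LinearMap.ext fun θ => ?_)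
    have h0 : ∀ x, f.1 (Pi.single x 1) = 0 := fun x => congrFun (congrArg Subtype.val hf) x
    rw [← hsum]
    simp [h0]
  have := LinearMap.finrank_le_finrank_of_injective hL
  omega

theorem finrank_extTangent_le_dim_add_one (E : ExponentialFamily X) :
    Module.finrank ℝ E.extTangent ≤ E.dim + 1 := by
  set S : Submodule ℝ (X → ℝ) := Submodule.span ℝ {(fun _ => 1 : X → ℝ)} with hS
  have h1 := LinearMap.finrank_range_add_finrank_ker (S.mkQ.domRestrict E.extTangent)
  rw [LinearMap.range_domRestrict] at h1
  have h2 : Module.finrank ℝ (LinearMap.ker (S.mkQ.domRestrict E.extTangent))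
      ≤ Module.finrank ℝ S := by
    refine LinearMap.finrank_le_finrank_of_injective
      (f := (E.extTangent.subtype.comp (Submodule.subtype _)).codRestrict S fun v => ?_) ?_
    · have := v.2
      rw [LinearMap.mem_ker, LinearMap.domRestrict_apply, Submodule.mkQ_apply,
        Submodule.Quotient.mk_eq_zero] at this
      exact this
    · intro v w hvw
      exact Subtype.ext (Subtype.ext (congrArg (fun z : S => (z : X → ℝ)) hvw))
  have h3 : Module.finrank ℝ S ≤ 1 := by
    simpa using finrank_span_le_card (R := ℝ) {(fun _ => 1 : X → ℝ)}
  change _ ≤ Module.finrank ℝ (E.extTangent.map S.mkQ) + 1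
  omega

/-- On the normal space, the reference measure may be replaced by any member of the family. -/
theorem signedDivergence_eq_of_mem_members (E : ExponentialFamily X) {u Q : X → ℝ}
    (hu : u ∈ E.normalSpace) (hQ : Q ∈ E.members) :
    (∀ x, 0 < Q x) ∧ signedDivergence Q u = signedDivergence E.refMeasure u := by
  obtain ⟨⟨-, hQ1⟩, θ, hθ, hQθ⟩ := hQ
  set Z := ∑ y, E.refMeasure y * Real.exp (θ y) with hZ
  have hZ0 : Z ≠ 0 := by
    intro h
    simp [hQθ, h] at hQ1
  have hZpos : 0 < Z := lt_of_le_of_ne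
    (Finset.sum_nonneg fun y _ => (mul_pos (E.refMeasure_pos y) (Real.exp_pos _)).le) hZ0.symm
  refine ⟨fun x => hQθ x ▸
    mul_pos (div_pos (E.refMeasure_pos x) hZpos) (Real.exp_pos _), ?_⟩
  -- The `log Z` and `θ` terms sum to zero because `u` is orthogonal to the constants and to `θ`.
  have h : ∀ x, u x * Real.log (u x / Q x)
      = u x * Real.log (u x / E.refMeasure x) + Real.log Z * u x - u x * θ x := by
    intro x
    by_cases hx : u x = 0
    · simp [hx]
    · have hν := (E.refMeasure_pos x).ne'
      rw [hQθ x, Real.log_div hx (by positivity), Real.log_mul (by positivity) (by positivity),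
        Real.log_div hν hZ0, Real.log_div hx hν, Real.log_exp]
      ring
  simp only [signedDivergence, h, Finset.sum_sub_distrib, Finset.sum_add_distrib,
    ← Finset.mul_sum, E.sum_eq_zero_of_mem_normalSpace hu, hu θ hθ]
  ring

theorem signedDivergence_nonpos_of_divergenceFrom_le (E : ExponentialFamily X)
    (h : ∀ P ∈ stdSimplex ℝ X, E.divergenceFrom P ≤ ((Real.log 2 : ℝ) : EReal))
    {u : X → ℝ} (hu : u ∈ E.normalSpace) : signedDivergence E.refMeasure u ≤ 0 := by
  have hsum := E.sum_eq_zero_of_mem_normalSpace hu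
  have hsplit : ∑ x, max (u x) 0 = ∑ x, max (-u x) 0 := by
    rw [← sub_eq_zero, ← Finset.sum_sub_distrib]
    refine Eq.trans (Finset.sum_congr rfl fun x _ => ?_) hsum
    rcases le_total 0 (u x) with h | h
    · simp [max_eq_left h, max_eq_right (neg_nonpos.2 h)]
    · simp [max_eq_right h, max_eq_left (neg_nonneg.2 h)]
  set c := ∑ x, max (u x) 0 with hc
  have hc0 : 0 ≤ c := Finset.sum_nonneg fun x _ => le_max_right _ _
  -- If the common mass `c` of both parts is zero, then `u = 0`; otherwise divide by it.
  rcases hc0.eq_or_lt with hc0 | hc0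
  · have hz1 := (Finset.sum_eq_zero_iff_of_nonneg (s := Finset.univ)
      fun x _ => le_max_right (u x) 0).1 hc0.symm
    have hz2 := (Finset.sum_eq_zero_iff_of_nonneg fun x _ => le_max_right (-u x) 0).1
      (hsplit.symm.trans hc0.symm)
    refine le_of_eq (Finset.sum_eq_zero fun x hx => ?_)
    have h1 := le_max_left (u x) 0
    have h2 := le_max_left (-u x) 0
    rw [hz1 x hx] at h1
    rw [hz2 x hx] at h2
    simp [show u x = 0 by linarith]
  set w := c⁻¹ • u with hw
  have hwN : w ∈ E.normalSpace := E.normalSpace.smul_mem _ hu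
  have hcinv : 0 < c⁻¹ := inv_pos.2 hc0
  have hp : ∑ x, max (w x) 0 = 1 := by
    have : ∀ x, max (w x) 0 = c⁻¹ * max (u x) 0 := fun x => by
      rw [mul_max_of_nonneg _ _ hcinv.le]; simp [hw]
    simp only [this, ← Finset.mul_sum]
    exact inv_mul_cancel₀ hc0.ne'
  have hn : ∑ x, max (-w x) 0 = 1 := by
    have : ∀ x, max (-w x) 0 = c⁻¹ * max (-u x) 0 := fun x => by
      rw [mul_max_of_nonneg _ _ hcinv.le]; simp [hw]
    simp only [this, ← Finset.mul_sum, ← hsplit]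
    exact inv_mul_cancel₀ hc0.ne'
  have hlow : ((Real.log (1 + Real.exp (signedDivergence E.refMeasure w)) : ℝ) : EReal)
      ≤ E.divergenceFrom fun x => max (w x) 0 := by
    refine le_iInf₂ fun Q hQ => ?_
    obtain ⟨hQpos, hQw⟩ := E.signedDivergence_eq_of_mem_members hwN hQ
    rw [infDivergence, if_pos fun x hx => absurd hx (hQpos x).ne', EReal.coe_le_coe_iff, ← hQw]
    exact log_one_add_exp_signedDivergence_le hQpos hQ.1.2 hp hn
  have hle := hlow.trans (h _ ⟨fun x => le_max_right _ _, hp⟩)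
  rw [EReal.coe_le_coe_iff, Real.log_le_log_iff (by positivity) (by norm_num)] at hle
  have hexp : Real.exp (signedDivergence E.refMeasure w) ≤ 1 := by linarith
  rw [Real.exp_le_one_iff, hw, signedDivergence_smul E.refMeasure_pos hsum hcinv.ne'] at hexp
  exact nonpos_of_mul_nonpos_right hexp hcinv

/-- The signed divergence is odd, so the upper bound applied to `u` and `-u` gives zero. -/
theorem signedDivergence_eq_zero_of_divergenceFrom_le (E : ExponentialFamily X)
    (h : ∀ P ∈ stdSimplex ℝ X, E.divergenceFrom P ≤ ((Real.log 2 : ℝ) : EReal))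
    {u : X → ℝ} (hu : u ∈ E.normalSpace) : signedDivergence E.refMeasure u = 0 := by
  have h1 := E.signedDivergence_nonpos_of_divergenceFrom_le h hu
  have h2 := E.signedDivergence_nonpos_of_divergenceFrom_le h (E.normalSpace.neg_mem hu)
  rw [signedDivergence_neg] at h2
  linarith

theorem exists_coparallel_ne_of_divergenceFrom_le (E : ExponentialFamily X)
    (h : ∀ P ∈ stdSimplex ℝ X, E.divergenceFrom P ≤ ((Real.log 2 : ℝ) : EReal))
    {x : X} (hx : x ∈ spaceSupport E.normalSpace) :
    ∃ y, y ≠ x ∧ Coparallel E.normalSpace x y := by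
  obtain ⟨u, hu, huZ⟩ := exists_zero_set_eq_coparallel E.normalSpace hx
  obtain ⟨v, hv, hvx⟩ := hx
  have hsum := sum_eq_zero_of_signedDivergence_eq_zero E.refMeasure_pos (u := u) (v := v)
    fun t => E.signedDivergence_eq_zero_of_divergenceFrom_le h
      (E.normalSpace.add_mem hu (E.normalSpace.smul_mem t hv))
  by_contra! hcon
  rw [Finset.sum_eq_single x] at hsum
  · exact hvx hsum
  -- Zeros of `u` outside the support of the normal space do not matter, since `v` vanishes there. A
  -- singleton class would leave only the term `v x ≠ 0`.
  · intro y hy hyx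
    by_contra hvy
    exact hcon y hyx ((huZ y ⟨v, hv, hvy⟩).1 (Finset.mem_filter.1 hy).2)
  · intro hnot
    refine absurd (Finset.mem_filter.2 ⟨Finset.mem_univ x, ?_⟩) hnot
    exact (huZ x ⟨v, hv, hvx⟩).2 ⟨⟨v, hv, hvx⟩, ⟨v, hv, hvx⟩, fun _ _ h => h⟩

end ExponentialFamily

theorem mainTheorem2 {X : Type*} [Fintype X] (E : ExponentialFamily X)
    (hmax : IsGreatest (E.divergenceFrom '' stdSimplex ℝ X) ((Real.log 2 : ℝ) : EReal)) :
    ⌈(Fintype.card X : ℚ) / 2⌉ - 1 ≤ (E.dim : ℤ) ∧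
      ∀ Z : Set X, IsCoparallelClass E.normalSpace Z →
        2 ≤ Z.ncard ∧ (matroidOfSpace E.normalSpace)✶.eRk Z = 1 := by
  have h : ∀ P ∈ stdSimplex ℝ X, E.divergenceFrom P ≤ ((Real.log 2 : ℝ) : EReal) :=
    fun P hP => hmax.2 (Set.mem_image_of_mem _ hP)
  refine ⟨?_, fun Z hZ => ⟨?_, hZ.dual_eRk_eq_one⟩⟩
  · have h1 := two_mul_finrank_le_card E.normalSpace
      fun x hx => E.exists_coparallel_ne_of_divergenceFrom_le h hx
    have h2 := E.card_le_finrank_add_finrank_normalSpace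
    have h3 := E.finrank_extTangent_le_dim_add_one
    have h4 : Fintype.card X ≤ 2 * (E.dim + 1) := by omega
    rw [sub_le_iff_le_add, Int.ceil_le]
    have h5 : (Fintype.card X : ℚ) ≤ 2 * (E.dim + 1) := by exact_mod_cast h4
    push_cast
    linarith
  · obtain ⟨x, hx, rfl⟩ := hZ
    obtain ⟨y, hyx, hy⟩ := E.exists_coparallel_ne_of_divergenceFrom_le h hx
    have hsub : ({y, x} : Set X) ⊆ {y | Coparallel E.normalSpace x y} :=
      Set.insert_subset hy (Set.singleton_subset_iff.2 ⟨hx, hx, fun _ _ h => h⟩)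
    rw [← Set.ncard_pair hyx]
    exact Set.ncard_le_ncard hsub (Set.toFinite _)
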